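/- Let $\mathbb F$ be a field. For a Lie algebra $L$ over $\mathbb F$, its nonabelian tensor square $L\otimes L$ is the Lie algebra over $\mathbb F$ generated by the symbols $l\otimes k$ ($l,k\in L$) subject to the relations $$c(l\otimes k)=cl\otimes k=l\otimes ck,\quad (l+l')\otimes k=l\otimes k+l'\otimes k,\quad l\otimes(k+k')=l\otimes k+l\otimes k',$$ $$[l,l']\otimes k=l\otimes[l',k]-l'\otimes[l,k],\quad l\otimes[k,k']=[k',l]\otimes k-[k,l]\otimes k',\quad [l\otimes k,\,l'\otimes k']=-[k,l]\otimes[l',k']$$ for all $c\in\mathbb F$ and $l,l',k,k'\in L$. Let $A(n)$ be the abelian Lie algebra of dimension $n$, and let $H(m)$ be the Heisenberg Lie algebra with basis $x_1,\dots,x_{2m},x$ and nonzero brackets $[x_{2i-1},x_{2i}]=x=-[x_{2i},x_{2i-1}]$ for $1\le i\le m$. Let $L_{4,3}$ have basis $x_1,\dots,x_4$ and nonzero brackets $[x_1,x_2]=x_3$, $[x_1,x_3]=x_4$. Put $L_{5,1}=A(5)$, $L_{5,2}=H(1)\oplus A(2)$, $L_{5,3}=L_{4,3}\oplus A(1)$,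 $L_{5,4}=H(2)$, and let $L_{5,5},\dots,L_{5,9}$ have basis $x_1,\dots,x_5$ and the following nonzero brackets (together with those that follow by antisymmetry): - $L_{5,5}$: $[x_1,x_2]=x_3$, $[x_1,x_3]=[x_2,x_4]=x_5$; - $L_{5,6}$: $[x_1,x_2]=x_3$, $[x_1,x_3]=x_4$, $[x_1,x_4]=[x_2,x_3]=x_5$; - $L_{5,7}$: $[x_1,x_2]=x_3$, $[x_1,x_3]=x_4$, $[x_1,x_4]=x_5$; - $L_{5,8}$: $[x_1,x_2]=x_4$, $[x_1,x_3]=x_5$; - $L_{5,9}$: $[x_1,x_2]=x_3$, $[x_1,x_3]=x_4$, $[x_2,x_3]=x_5$. Then, as Lie algebras over $\mathbb F$, $$L_{5,k}\otimes L_{5,k}\cong\begin{cases}A(9)&\text{if }k=9,\\ A(12)&\text{if }k=3,5,\\ A(14)&\text{if }k=8,\\ A(16)&\text{if }k=4,\\ A(18)&\text{if }k=2,\\ A(25)&\text{if }k=1,\\ H(1)\oplus A(6)&\text{if }k=6,7.\end{cases}$$ -/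

import Mathlib

/-! ## The nonabelian tensor square of a Lie algebra -/

/-- The defining relations of the nonabelian tensor square of a Lie algebra `L`, between elements of
the free Lie algebra on the symbols `l ⊗ k` (the generator attached to the pair `(l, k)`), where
`L` acts on itself by `ˡk = ⁅l, k⁆`. -/
inductive NonabelianTensorSquare.Rel (F L : Type*) [Field F] [LieRing L] [LieAlgebra F L] :
    FreeLieAlgebra F (L × L) → FreeLieAlgebra F (L × L) → Prop
  | smul_left (c : F) (l k : L) :
      Rel F L (c • FreeLieAlgebra.of F (l, k)) (FreeLieAlgebra.of F (c • l, k))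
  | smul_right (c : F) (l k : L) :
      Rel F L (c • FreeLieAlgebra.of F (l, k)) (FreeLieAlgebra.of F (l, c • k))
  | add_left (l l' k : L) :
      Rel F L (FreeLieAlgebra.of F (l + l', k))
        (FreeLieAlgebra.of F (l, k) + FreeLieAlgebra.of F (l', k))
  | add_right (l k k' : L) :
      Rel F L (FreeLieAlgebra.of F (l, k + k'))
        (FreeLieAlgebra.of F (l, k) + FreeLieAlgebra.of F (l, k'))
  | lie_left (l l' k : L) :
      Rel F L (FreeLieAlgebra.of F (⁅l, l'⁆, k))
        (FreeLieAlgebra.of F (l, ⁅l', k⁆) - FreeLieAlgebra.of F (l', ⁅l, k⁆))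
  | lie_right (l k k' : L) :
      Rel F L (FreeLieAlgebra.of F (l, ⁅k, k'⁆))
        (FreeLieAlgebra.of F (⁅k', l⁆, k) - FreeLieAlgebra.of F (⁅k, l⁆, k'))
  | lie_lie (l k l' k' : L) :
      Rel F L ⁅FreeLieAlgebra.of F (l, k), FreeLieAlgebra.of F (l', k')⁆
        (-FreeLieAlgebra.of F (⁅k, l⁆, ⁅l', k'⁆))

/-- The ideal of the free Lie algebra on the symbols `l ⊗ k` generated by the defining relations. -/
noncomputable def NonabelianTensorSquare.relIdeal (F L : Type*) [Field F] [LieRing L] [LieAlgebra F L] :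
    LieIdeal F (FreeLieAlgebra F (L × L)) :=
  LieSubmodule.lieSpan F (FreeLieAlgebra F (L × L))
    {x | ∃ a b, NonabelianTensorSquare.Rel F L a b ∧ x = a - b}

/-- The nonabelian tensor square `L ⊗ L`: the Lie algebra generated by the symbols `l ⊗ k`
subject to the relations `NonabelianTensorSquare.Rel`. -/
abbrev NonabelianTensorSquare (F L : Type*) [Field F] [LieRing L] [LieAlgebra F L] : Type _ :=
  FreeLieAlgebra F (L × L) ⧸ NonabelianTensorSquare.relIdeal F L

/-! ## Abelian and Heisenberg Lie algebras -/

/-- `A(n)`: the abelian Lie algebra of dimension `n`. -/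
def AbelianLie (F : Type*) (n : ℕ) : Type _ := Fin n → F

namespace AbelianLie

variable (F : Type*) [Field F] (n : ℕ)

instance : AddCommGroup (AbelianLie F n) := inferInstanceAs (AddCommGroup (Fin n → F))
instance : Module F (AbelianLie F n) := inferInstanceAs (Module F (Fin n → F))

instance : LieRing (AbelianLie F n) where
  bracket _ _ := 0
  add_lie _ _ _ := (add_zero 0).symm
  lie_add _ _ _ := (add_zero 0).symm
  lie_self _ := rfl
  leibniz_lie _ _ _ := (add_zero 0).symm

instance : LieAlgebra F (AbelianLie F n) where
  lie_smul t _ _ := (smul_zero t).symm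

end AbelianLie

/-- `H(m)`: the Heisenberg Lie algebra of dimension `2 m + 1`. The element `(a, b, c)` stands for
`∑ i, (a i • x_{2i-1} + b i • x_{2i}) + c • x`, where `[x_{2i-1}, x_{2i}] = x` and all other brackets
of basis vectors vanish. -/
def HeisenbergLie (F : Type*) (m : ℕ) : Type _ := (Fin m → F) × (Fin m → F) × F

namespace HeisenbergLie

variable (F : Type*) [Field F] (m : ℕ)

instance : AddCommGroup (HeisenbergLie F m) :=
  inferInstanceAs (AddCommGroup ((Fin m → F) × (Fin m → F) × F))
instance : Module F (HeisenbergLie F m) :=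
  inferInstanceAs (Module F ((Fin m → F) × (Fin m → F) × F))

instance : Bracket (HeisenbergLie F m) (HeisenbergLie F m) where
  bracket u v := ((0, 0, ∑ i, (u.1 i * v.2.1 i - u.2.1 i * v.1 i)) :
    (Fin m → F) × (Fin m → F) × F)

theorem bracket_def (u v : HeisenbergLie F m) :
    ⁅u, v⁆ = ((0, 0, ∑ i, (u.1 i * v.2.1 i - u.2.1 i * v.1 i)) :
      (Fin m → F) × (Fin m → F) × F) := rfl

instance : LieRing (HeisenbergLie F m) where
  add_lie u v w := by
    refine Prod.ext (add_zero 0).symm (Prod.ext (add_zero 0).symm ?_)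
    change ∑ i, ((u.1 i + v.1 i) * w.2.1 i - (u.2.1 i + v.2.1 i) * w.1 i) =
      ∑ i, (u.1 i * w.2.1 i - u.2.1 i * w.1 i) + ∑ i, (v.1 i * w.2.1 i - v.2.1 i * w.1 i)
    rw [← Finset.sum_add_distrib]
    exact Finset.sum_congr rfl fun i _ => by ring
  lie_add u v w := by
    refine Prod.ext (add_zero 0).symm (Prod.ext (add_zero 0).symm ?_)
    change ∑ i, (u.1 i * (v.2.1 i + w.2.1 i) - u.2.1 i * (v.1 i + w.1 i)) =
      ∑ i, (u.1 i * v.2.1 i - u.2.1 i * v.1 i) + ∑ i, (u.1 i * w.2.1 i - u.2.1 i * w.1 i)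
    rw [← Finset.sum_add_distrib]
    exact Finset.sum_congr rfl fun i _ => by ring
  lie_self u := by
    refine Prod.ext rfl (Prod.ext rfl ?_)
    change ∑ i, (u.1 i * u.2.1 i - u.2.1 i * u.1 i) = 0
    exact Finset.sum_eq_zero fun i _ => by ring
  leibniz_lie u v w := by
    refine Prod.ext (add_zero 0).symm (Prod.ext (add_zero 0).symm ?_)
    change ∑ i, (u.1 i * 0 - u.2.1 i * 0) =
      ∑ i, (0 * w.2.1 i - 0 * w.1 i) + ∑ i, (v.1 i * 0 - v.2.1 i * 0)
    simp

instance : LieAlgebra F (HeisenbergLie F m) where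
  lie_smul t u v := by
    refine Prod.ext (smul_zero t).symm (Prod.ext (smul_zero t).symm ?_)
    change ∑ i, (u.1 i * (t * v.2.1 i) - u.2.1 i * (t * v.1 i)) =
      t * ∑ i, (u.1 i * v.2.1 i - u.2.1 i * v.1 i)
    rw [Finset.mul_sum]
    exact Finset.sum_congr rfl fun i _ => by ring

end HeisenbergLie

/-! ## The nilpotent Lie algebras of dimension five -/

/-- A Lie bracket on the coordinate space `Fin n → F`: an `F`-bilinear alternating operation
satisfying the Jacobi identity. -/
structure CoordBracket (F : Type*) [Field F] (n : ℕ) where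
  /-- The bracket operation. -/
  br : (Fin n → F) → (Fin n → F) → Fin n → F
  add_br : ∀ u v w, br (u + v) w = br u w + br v w := by
    intros; ext i; fin_cases i <;> simp <;> ring
  br_add : ∀ u v w, br u (v + w) = br u v + br u w := by
    intros; ext i; fin_cases i <;> simp <;> ring
  br_smul : ∀ (t : F) (u v), br u (t • v) = t • br u v := by
    intros; ext i; fin_cases i <;> simp <;> ring
  br_self : ∀ u, br u u = 0 := by
    intros; ext i; fin_cases i <;> simp <;> ring
  jacobi : ∀ u v w, br u (br v w) = br (br u v) w + br v (br u w) := by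
    intros; ext i; fin_cases i <;> simp <;> ring

/-- The Lie algebra with underlying space `Fin n → F` and bracket `B`. Its standard basis
`x_1, …, x_n` is `Pi.single 0 1, …, Pi.single (n - 1) 1`, so that `u 0` is the coefficient of `x_1`
in `u`, and so on. -/
def CoordLie {F : Type*} [Field F] {n : ℕ} (_B : CoordBracket F n) : Type _ := Fin n → F

namespace CoordLie

variable {F : Type*} [Field F] {n : ℕ} (B : CoordBracket F n)

instance : AddCommGroup (CoordLie B) := inferInstanceAs (AddCommGroup (Fin n → F))
instance : Module F (CoordLie B) := inferInstanceAs (Module F (Fin n → F))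

instance : LieRing (CoordLie B) where
  bracket u v := B.br u v
  add_lie := B.add_br
  lie_add := B.br_add
  lie_self := B.br_self
  leibniz_lie := B.jacobi

instance : LieAlgebra F (CoordLie B) where
  lie_smul := B.br_smul

end CoordLie

/-- The bracket on `F^4` whose nonzero brackets of basis vectors are
`[x_1, x_2] = x_3`, `[x_1, x_3] = x_4` (and those following by antisymmetry). -/
def L4_3.bracket (F : Type*) [Field F] : CoordBracket F 4 where
  br u v := ![0, 0, u 0 * v 1 - u 1 * v 0, u 0 * v 2 - u 2 * v 0]

/-- `L_{4,3}`: basis `x_1, …, x_4`, nonzero brackets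
`[x_1, x_2] = x_3`, `[x_1, x_3] = x_4`. -/
abbrev L4_3 (F : Type*) [Field F] : Type _ := CoordLie (L4_3.bracket F)

/-- `L_{5,1} = A(5)`. -/
abbrev L5_1 (F : Type*) : Type _ := AbelianLie F 5

/-- `L_{5,2} = H(1) ⊕ A(2)`. -/
abbrev L5_2 (F : Type*) : Type _ := HeisenbergLie F 1 × AbelianLie F 2

/-- `L_{5,3} = L_{4,3} ⊕ A(1)`. -/
abbrev L5_3 (F : Type*) [Field F] : Type _ := L4_3 F × AbelianLie F 1

/-- `L_{5,4} = H(2)`. -/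
abbrev L5_4 (F : Type*) : Type _ := HeisenbergLie F 2

/-- The bracket on `F^5` whose nonzero brackets of basis vectors are
`[x_1, x_2] = x_3`, `[x_1, x_3] = [x_2, x_4] = x_5` (and those following by antisymmetry). -/
def L5_5.bracket (F : Type*) [Field F] : CoordBracket F 5 where
  br u v := ![0, 0, u 0 * v 1 - u 1 * v 0, 0, (u 0 * v 2 - u 2 * v 0) + (u 1 * v 3 - u 3 * v 1)]

/-- `L_{5,5}`: basis `x_1, …, x_5`, nonzero brackets
`[x_1, x_2] = x_3`, `[x_1, x_3] = [x_2, x_4] = x_5`. -/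
abbrev L5_5 (F : Type*) [Field F] : Type _ := CoordLie (L5_5.bracket F)

/-- The bracket on `F^5` whose nonzero brackets of basis vectors are
`[x_1, x_2] = x_3`, `[x_1, x_3] = x_4`, `[x_1, x_4] = [x_2, x_3] = x_5` (and those following by antisymmetry). -/
def L5_6.bracket (F : Type*) [Field F] : CoordBracket F 5 where
  br u v := ![0, 0, u 0 * v 1 - u 1 * v 0, u 0 * v 2 - u 2 * v 0, (u 0 * v 3 - u 3 * v 0) + (u 1 * v 2 - u 2 * v 1)]

/-- `L_{5,6}`: basis `x_1, …, x_5`, nonzero brackets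
`[x_1, x_2] = x_3`, `[x_1, x_3] = x_4`, `[x_1, x_4] = [x_2, x_3] = x_5`. -/
abbrev L5_6 (F : Type*) [Field F] : Type _ := CoordLie (L5_6.bracket F)

/-- The bracket on `F^5` whose nonzero brackets of basis vectors are
`[x_1, x_2] = x_3`, `[x_1, x_3] = x_4`, `[x_1, x_4] = x_5` (and those following by antisymmetry). -/
def L5_7.bracket (F : Type*) [Field F] : CoordBracket F 5 where
  br u v := ![0, 0, u 0 * v 1 - u 1 * v 0, u 0 * v 2 - u 2 * v 0, u 0 * v 3 - u 3 * v 0]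

/-- `L_{5,7}`: basis `x_1, …, x_5`, nonzero brackets
`[x_1, x_2] = x_3`, `[x_1, x_3] = x_4`, `[x_1, x_4] = x_5`. -/
abbrev L5_7 (F : Type*) [Field F] : Type _ := CoordLie (L5_7.bracket F)

/-- The bracket on `F^5` whose nonzero brackets of basis vectors are
`[x_1, x_2] = x_4`, `[x_1, x_3] = x_5` (and those following by antisymmetry). -/
def L5_8.bracket (F : Type*) [Field F] : CoordBracket F 5 where
  br u v := ![0, 0, 0, u 0 * v 1 - u 1 * v 0, u 0 * v 2 - u 2 * v 0]

/-- `L_{5,8}`: basis `x_1, …, x_5`, nonzero brackets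
`[x_1, x_2] = x_4`, `[x_1, x_3] = x_5`. -/
abbrev L5_8 (F : Type*) [Field F] : Type _ := CoordLie (L5_8.bracket F)

/-- The bracket on `F^5` whose nonzero brackets of basis vectors are
`[x_1, x_2] = x_3`, `[x_1, x_3] = x_4`, `[x_2, x_3] = x_5` (and those following by antisymmetry). -/
def L5_9.bracket (F : Type*) [Field F] : CoordBracket F 5 where
  br u v := ![0, 0, u 0 * v 1 - u 1 * v 0, u 0 * v 2 - u 2 * v 0, u 1 * v 2 - u 2 * v 1]

/-- `L_{5,9}`: basis `x_1, …, x_5`, nonzero brackets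
`[x_1, x_2] = x_3`, `[x_1, x_3] = x_4`, `[x_2, x_3] = x_5`. -/
abbrev L5_9 (F : Type*) [Field F] : Type _ := CoordLie (L5_9.bracket F)

/-!
The symbols `l ⊗ k` already span `L ⊗ L` linearly, because the bracket of two symbols is the symbol
of two brackets (`span_tmul`). The remaining relations say, for bilinear symbols, that
`[a, b] ⊗ c = -(c ⊗ [a, b])` and `[a, b] ⊗ c + [b, c] ⊗ a + [c, a] ⊗ b = 0`
(`lie_tmul_comm`, `lie_tmul_cyclic`), and `[t, t] = 0` gives `[a, b] ⊗ [a, b] = 0`.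

Let `b` be a basis of `L`. Each of the algebras here has a basis for which the bracket of two basis
vectors is an integer multiple of a basis vector, and it turns out that some of the symbols
`b i ⊗ b j` form a basis of `L ⊗ L` of which all the other `b i ⊗ b j` are integer multiples of one
vector each, with coefficients `0, 1, -1`; this holds over every field. Hence everything is encoded
in tables of integers. One direction is that the prescribed values of the symbols in the target
algebra satisfy the relations, a finite verification in integers which yields a homomorphism out of
`L ⊗ L` (`exists_lift`). The other is that the relations force the symbols to be the prescribed
multiples of the chosen ones, which yields an inverse linear map. Both are combined in
`nonempty_lieEquiv_of_table`.

For `L_{5,6}` and `L_{5,7}` the only nonzero bracket between chosen symbols is, up to sign,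
`[x₁ ⊗ x₂, x₁ ⊗ x₃] = [x₁, x₂] ⊗ [x₁, x₃] = x₃ ⊗ x₄`, where `x₁ ⊗ x₂` may be replaced by
`-(x₂ ⊗ x₁)`; this is the summand `H(1)`. For the other algebras the symbols
`[a, b] ⊗ [c, d]` vanish, so `L ⊗ L` is abelian.
-/

namespace NonabelianTensorSquare

/-! ### Symbols and the universal property -/

section General

variable {F L M : Type*} [Field F] [LieRing L] [LieAlgebra F L] [LieRing M] [LieAlgebra F M]

variable (F) in
/-- The class `l ⊗ k` of the generator attached to `(l, k)`. -/
noncomputable def tmul (l k : L) : NonabelianTensorSquare F L :=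
  LieSubmodule.Quotient.mk (FreeLieAlgebra.of F (l, k))

theorem mk_eq_of_rel {a b : FreeLieAlgebra F (L × L)} (h : Rel F L a b) :
    (LieSubmodule.Quotient.mk a : NonabelianTensorSquare F L) = LieSubmodule.Quotient.mk b :=
  (Submodule.Quotient.eq _).2 (LieSubmodule.subset_lieSpan ⟨a, b, h, rfl⟩)

theorem smul_tmul (c : F) (l k : L) : tmul F (c • l) k = c • tmul F l k :=
  (mk_eq_of_rel (Rel.smul_left c l k)).symm

theorem tmul_smul (c : F) (l k : L) : tmul F l (c • k) = c • tmul F l k :=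
  (mk_eq_of_rel (Rel.smul_right c l k)).symm

theorem add_tmul (l l' k : L) : tmul F (l + l') k = tmul F l k + tmul F l' k :=
  mk_eq_of_rel (Rel.add_left l l' k)

theorem tmul_add (l k k' : L) : tmul F l (k + k') = tmul F l k + tmul F l k' :=
  mk_eq_of_rel (Rel.add_right l k k')

theorem lie_tmul (l l' k : L) :
    tmul F ⁅l, l'⁆ k = tmul F l ⁅l', k⁆ - tmul F l' ⁅l, k⁆ :=
  mk_eq_of_rel (Rel.lie_left l l' k)

theorem tmul_lie (l k k' : L) :
    tmul F l ⁅k, k'⁆ = tmul F ⁅k', l⁆ k - tmul F ⁅k, l⁆ k' :=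
  mk_eq_of_rel (Rel.lie_right l k k')

variable (F L) in
/-- The symbol `l ⊗ k` as a bilinear map. -/
noncomputable def tmulₗ : L →ₗ[F] L →ₗ[F] NonabelianTensorSquare F L :=
  LinearMap.mk₂ F (tmul F) add_tmul smul_tmul tmul_add tmul_smul

theorem tmulₗ_apply (l k : L) : tmulₗ F L l k = tmul F l k := rfl

theorem tmul_neg (l k : L) : tmul F l (-k) = -tmul F l k := (tmulₗ F L l).map_neg k

theorem neg_tmul (l k : L) : tmul F (-l) k = -tmul F l k := LinearMap.map_neg₂ (tmulₗ F L) l k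

theorem lie_tmul_tmul (l k l' k' : L) :
    ⁅tmul F l k, tmul F l' k'⁆ = tmul F ⁅l, k⁆ ⁅l', k'⁆ := by
  rw [← lie_skew l k, neg_tmul]
  exact mk_eq_of_rel (Rel.lie_lie l k l' k')

/-- Symbols with a bracket among their two entries are antisymmetric. -/
theorem lie_tmul_comm (a b c : L) : tmul F ⁅a, b⁆ c = -tmul F c ⁅a, b⁆ := by
  have h := tmul_lie (F := F) c a b
  rw [lie_tmul b c a, lie_tmul a c b, ← lie_skew b a, ← lie_skew c a, ← lie_skew c b, tmul_neg,
    tmul_neg, tmul_neg] at h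
  rw [lie_tmul a b c]
  linear_combination (norm := abel) -h

/-- The Jacobi-type identity that, together with `lie_tmul_comm`, is equivalent to the relations
`lie_tmul` and `tmul_lie`. -/
theorem lie_tmul_cyclic (a b c : L) :
    tmul F ⁅a, b⁆ c + tmul F ⁅b, c⁆ a + tmul F ⁅c, a⁆ b = 0 := by
  rw [lie_tmul_comm b c, lie_tmul_comm c a, lie_tmul, ← lie_skew c a, tmul_neg]
  abel

/-- This reflects that `⁅t, t⁆ = 0` for `t = a ⊗ b`, and in characteristic two does not follow from
`lie_tmul_comm`. -/
theorem lie_tmul_lie_self (a b : L) : tmul F ⁅a, b⁆ ⁅a, b⁆ = 0 := by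
  rw [← lie_tmul_tmul, lie_self]

/-- Since a bracket of symbols is again a symbol, the symbols span `L ⊗ L` linearly. -/
theorem span_tmul : Submodule.span F {t | ∃ l k : L, t = tmul F l k} = ⊤ := by
  let S : LieSubalgebra F (NonabelianTensorSquare F L) :=
    { Submodule.span F {t | ∃ l k : L, t = tmul F l k} with
      lie_mem' := by
        intro x y hx hy
        refine Submodule.span_induction₂ (p := fun x y _ _ =>
          ⁅x, y⁆ ∈ Submodule.span F {t | ∃ l k : L, t = tmul F l k}) ?_ ?_ ?_ ?_ ?_ ?_ ?_ hx hy
        · rintro _ _ ⟨l, k, rfl⟩ ⟨l', k', rfl⟩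
          exact Submodule.subset_span ⟨_, _, lie_tmul_tmul l k l' k'⟩
        · intro y _; simp
        · intro y _; simp
        · intro x y z _ _ _ h₁ h₂; rw [add_lie]; exact add_mem h₁ h₂
        · intro x y z _ _ _ h₁ h₂; rw [lie_add]; exact add_mem h₁ h₂
        · intro r x y _ _ h; rw [smul_lie]; exact Submodule.smul_mem _ r h
        · intro r x y _ _ h; rw [lie_smul]; exact Submodule.smul_mem _ r h }
  let f : FreeLieAlgebra F (L × L) →ₗ⁅F⁆ S := FreeLieAlgebra.lift F fun p =>
    ⟨tmul F p.1 p.2, Submodule.subset_span ⟨_, _, rfl⟩⟩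
  let q : FreeLieAlgebra F (L × L) →ₗ⁅F⁆ NonabelianTensorSquare F L :=
    { (relIdeal F L).toSubmodule.mkQ with map_lie' := fun {_ _} => rfl }
  have hf : S.incl.comp f = q := by
    refine FreeLieAlgebra.hom_ext fun p => ?_
    simp only [LieHom.comp_apply, f, FreeLieAlgebra.lift_of_apply]
    rfl
  refine eq_top_iff.2 fun t _ => ?_
  obtain ⟨a, rfl⟩ := Submodule.Quotient.mk_surjective _ t
  have h : S.incl (f a) = q a := LieHom.congr_fun hf a
  change q a ∈ S
  rw [← h]
  exact (f a).2

/-- The universal property: a bilinear map compatible with brackets that satisfies the identities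
`lie_tmul_comm`, `lie_tmul_cyclic` and `lie_tmul_tmul` factors through `L ⊗ L`. -/
theorem exists_lift (h : L →ₗ[F] L →ₗ[F] M) (hcomm : ∀ a b c : L, h ⁅a, b⁆ c = -h c ⁅a, b⁆)
    (hcyc : ∀ a b c : L, h ⁅a, b⁆ c + h ⁅b, c⁆ a + h ⁅c, a⁆ b = 0)
    (hlie : ∀ a b c d : L, ⁅h a b, h c d⁆ = h ⁅a, b⁆ ⁅c, d⁆) :
    ∃ φ : NonabelianTensorSquare F L →ₗ⁅F⁆ M, ∀ l k, φ (tmul F l k) = h l k := by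
  let f : FreeLieAlgebra F (L × L) →ₗ⁅F⁆ M := FreeLieAlgebra.lift F fun p => h p.1 p.2
  have hf (l k : L) : f (FreeLieAlgebra.of F (l, k)) = h l k :=
    FreeLieAlgebra.lift_of_apply _ _
  have hker : relIdeal F L ≤ f.ker := by
    refine LieSubmodule.lieSpan_le.2 ?_
    rintro _ ⟨a, b, hab, rfl⟩
    change a - b ∈ f.ker
    rw [LieHom.mem_ker, map_sub, sub_eq_zero]
    cases hab with
    | smul_left c l k => simp [hf]
    | smul_right c l k => simp [hf]
    | add_left l l' k => simp [hf]
    | add_right l k k' => simp [hf]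
    | lie_left l l' k =>
      have h₁ := hcyc l l' k
      rw [hcomm l' k l, hcomm k l l', ← lie_skew k l, map_neg] at h₁
      rw [map_sub, hf, hf, hf]
      linear_combination (norm := abel) h₁
    | lie_right l k k' =>
      have h₁ := hcyc k k' l
      rw [hcomm k k' l, ← lie_skew l k, map_neg, LinearMap.neg_apply] at h₁
      rw [map_sub, hf, hf, hf]
      linear_combination (norm := abel) -h₁
    | lie_lie l k l' k' =>
      rw [LieHom.map_lie, map_neg, hf, hf, hf, hlie, ← lie_skew l k, map_neg,
        LinearMap.neg_apply]
  refine ⟨{ (relIdeal F L).toSubmodule.liftQ (f : FreeLieAlgebra F (L × L) →ₗ[F] M) hker with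
    map_lie' := ?_ }, hf⟩
  intro x y
  obtain ⟨a, rfl⟩ := Submodule.Quotient.mk_surjective _ x
  obtain ⟨b, rfl⟩ := Submodule.Quotient.mk_surjective _ y
  exact f.map_lie a b

/-- A map `h` as in `exists_lift` induces an isomorphism as soon as some symbols `b i ⊗ b j` of basis
vectors are sent to a basis of `M`, and every symbol of basis vectors is the combination of those
that its image prescribes. -/
theorem nonempty_lieEquiv {ι κ : Type*} (b : Module.Basis ι F L) (s : Module.Basis κ F M)
    (h : L →ₗ[F] L →ₗ[F] M) (hcomm : ∀ x y z : L, h ⁅x, y⁆ z = -h z ⁅x, y⁆)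
    (hcyc : ∀ x y z : L, h ⁅x, y⁆ z + h ⁅y, z⁆ x + h ⁅z, x⁆ y = 0)
    (hlie : ∀ x y z u : L, ⁅h x y, h z u⁆ = h ⁅x, y⁆ ⁅z, u⁆)
    (p : κ → ι × ι) (hp : ∀ k, h (b (p k).1) (b (p k).2) = s k)
    (hgen : ∀ i j, s.constr F (fun k => tmul F (b (p k).1) (b (p k).2)) (h (b i) (b j)) =
      tmul F (b i) (b j)) :
    Nonempty (NonabelianTensorSquare F L ≃ₗ⁅F⁆ M) := by
  obtain ⟨φ, hφ⟩ := exists_lift h hcomm hcyc hlie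
  let g : M →ₗ[F] NonabelianTensorSquare F L :=
    s.constr F fun k => tmul F (b (p k).1) (b (p k).2)
  have hgh : h.compr₂ g = tmulₗ F L := b.ext fun i => b.ext fun j => hgen i j
  have hleft : g.comp (φ : NonabelianTensorSquare F L →ₗ[F] M) = LinearMap.id := by
    refine LinearMap.ext_on span_tmul ?_
    rintro _ ⟨l, k, rfl⟩
    change g (φ (tmul F l k)) = tmul F l k
    rw [hφ]
    exact LinearMap.congr_fun₂ hgh l k
  have hright : (φ : NonabelianTensorSquare F L →ₗ[F] M).comp g = LinearMap.id := by
    refine s.ext fun k => ?_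
    change φ (g (s k)) = s k
    rw [Module.Basis.constr_basis, hφ, hp]
  exact ⟨LieEquiv.ofBijective φ
    ⟨Function.LeftInverse.injective (g := g) fun t => LinearMap.congr_fun hleft t,
    Function.RightInverse.surjective (g := g) fun m => LinearMap.congr_fun hright m⟩⟩

end General

/-! ### Monomial multiplication tables -/

section Monomial

variable {F L M : Type*} [Field F] [LieRing L] [LieAlgebra F L] [LieRing M] [LieAlgebra F M]

/-- `b` is a basis of a Lie algebra in which the bracket of the `i`-th and the `j`-th basis vector
is the integer multiple `(c i j).1` of the basis vector with index `(c i j).2`. -/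
def IsLieTable {ι : Type*} (b : Module.Basis ι F L) (c : ι → ι → ℤ × ι) : Prop :=
  ∀ i j, ⁅b i, b j⁆ = (c i j).1 • b (c i j).2

/-- The `l`-th coefficient of the integer multiple `z.1` of the basis vector with index `z.2`. -/
def coeff {ι : Type*} [DecidableEq ι] (z : ℤ × ι) (l : ι) : ℤ := if z.2 = l then z.1 else 0

theorem sum_coeff_smul {κ V : Type*} [Fintype κ] [DecidableEq κ] [AddCommGroup V] (s : κ → V)
    (z : ℤ × κ) : ∑ l, coeff z l • s l = z.1 • s z.2 := by
  simp [coeff, ite_smul]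

/-- A property that is stable under linear combinations holds everywhere once it holds on a
basis. -/
theorem forall_of_basis {ι : Type*} (b : Module.Basis ι F L) {P : L → Prop} (hb : ∀ i, P (b i))
    (hadd : ∀ x y, P x → P y → P (x + y)) (hsmul : ∀ (r : F) x, P x → P (r • x)) (h0 : P 0)
    (x : L) : P x := by
  have hx : x ∈ Submodule.span F (Set.range b) := b.span_eq ▸ Submodule.mem_top
  induction hx using Submodule.span_induction with
  | mem x hx => obtain ⟨i, rfl⟩ := hx; exact hb i
  | zero => exact h0
  | add x y _ _ hx hy => exact hadd x y hx hy
  | smul r x _ hx => exact hsmul r x hx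

/-- The bilinear map that sends `(b i, b j)` to the multiple `(t i j).1` of the basis vector
`s (t i j).2`. -/
noncomputable def pairing {ι κ : Type*} (b : Module.Basis ι F L) (s : Module.Basis κ F M)
    (t : ι → ι → ℤ × κ) : L →ₗ[F] L →ₗ[F] M :=
  b.constr F fun i => b.constr F fun j => (t i j).1 • s (t i j).2

theorem pairing_basis {ι κ : Type*} (b : Module.Basis ι F L) (s : Module.Basis κ F M)
    (t : ι → ι → ℤ × κ) (i j : ι) : pairing b s t (b i) (b j) = (t i j).1 • s (t i j).2 := by
  simp [pairing]

/-- Recognition of `L ⊗ L` from integer tables. The tables `c` and `d` describe the brackets of `L`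
and `M`, and `t` the intended images of the symbols `b i ⊗ b j`, among which the pairs listed by `p`
have the basis of `M` as their images. The hypotheses `hcomm`, `hcyc` and `hlie` are the relations
of `L ⊗ L` read off from the tables; they involve integers only. What remains to be shown inside
`L ⊗ L` is `hgen`. -/
theorem nonempty_lieEquiv_of_table {ι κ : Type*} [Fintype κ] [DecidableEq κ]
    {b : Module.Basis ι F L} {s : Module.Basis κ F M} {c : ι → ι → ℤ × ι} {d : κ → κ → ℤ × κ}
    (hc : IsLieTable b c) (hd : IsLieTable s d) (t : ι → ι → ℤ × κ) (p : κ → ι × ι)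
    (hp : ∀ k, t (p k).1 (p k).2 = (1, k))
    (hcomm : ∀ i j k l, (c i j).1 * coeff (t (c i j).2 k) l =
      -((c i j).1 * coeff (t k (c i j).2) l))
    (hcyc : ∀ i j k l, (c i j).1 * coeff (t (c i j).2 k) l + (c j k).1 * coeff (t (c j k).2 i) l +
      (c k i).1 * coeff (t (c k i).2 j) l = 0)
    (hlie : ∀ i j i' j' l, (t i j).1 * (t i' j').1 * coeff (d (t i j).2 (t i' j').2) l =
      (c i j).1 * (c i' j').1 * coeff (t (c i j).2 (c i' j').2) l)
    (hgen : ∀ i j, tmul F (b i) (b j) =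
      (t i j).1 • tmul F (b (p (t i j).2).1) (b (p (t i j).2).2)) :
    Nonempty (NonabelianTensorSquare F L ≃ₗ⁅F⁆ M) := by
  have hpair (i j : ι) : pairing b s t (b i) (b j) = ∑ l, coeff (t i j) l • s l := by
    rw [pairing_basis, sum_coeff_smul]
  have hleft (i j k : ι) : pairing b s t ⁅b i, b j⁆ (b k) =
      ∑ l, ((c i j).1 * coeff (t (c i j).2 k) l) • s l := by
    simp only [hc i j, map_zsmul, LinearMap.smul_apply, hpair, mul_smul, Finset.smul_sum]
  have hright (i j k : ι) : pairing b s t (b k) ⁅b i, b j⁆ =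
      ∑ l, ((c i j).1 * coeff (t k (c i j).2) l) • s l := by
    simp only [hc i j, map_zsmul, hpair, mul_smul, Finset.smul_sum]
  refine nonempty_lieEquiv b s (pairing b s t) ?_ ?_ ?_ p ?_ ?_
  · refine forall_of_basis b (fun i => forall_of_basis b (fun j => forall_of_basis b (fun k => ?_)
      ?_ ?_ ?_) ?_ ?_ ?_) ?_ ?_ ?_
    · simp only [hleft, hright, hcomm, neg_smul, Finset.sum_neg_distrib]
    all_goals simp +contextual [-lie_skew, add_comm]
  · refine forall_of_basis b (fun i => forall_of_basis b (fun j => forall_of_basis b (fun k => ?_)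
      ?_ ?_ ?_) ?_ ?_ ?_) ?_ ?_ ?_
    · simp only [hleft, ← Finset.sum_add_distrib, ← add_smul, hcyc, zero_smul,
        Finset.sum_const_zero]
    · intro x y hx hy
      simp only [add_lie, lie_add, map_add, LinearMap.add_apply]
      linear_combination (norm := abel) hx + hy
    · intro r x hx
      simp only [smul_lie, lie_smul, map_smul, LinearMap.smul_apply, ← smul_add, hx, smul_zero]
    · simp
    · intro x y hx hy z
      simp only [add_lie, lie_add, map_add, LinearMap.add_apply]
      linear_combination (norm := abel) hx z + hy z
    · intro r x hx z
      simp only [smul_lie, lie_smul, map_smul, LinearMap.smul_apply, ← smul_add, hx, smul_zero]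
    · simp
    · intro x y hx hy z w
      simp only [add_lie, lie_add, map_add, LinearMap.add_apply]
      linear_combination (norm := abel) hx z w + hy z w
    · intro r x hx z w
      simp only [smul_lie, lie_smul, map_smul, LinearMap.smul_apply, ← smul_add, hx, smul_zero]
    · simp
  · refine forall_of_basis b (fun i => forall_of_basis b (fun j => forall_of_basis b (fun i' =>
      forall_of_basis b (fun j' => ?_) ?_ ?_ ?_) ?_ ?_ ?_) ?_ ?_ ?_) ?_ ?_ ?_
    · rw [pairing_basis, pairing_basis, hc i j, hc i' j', zsmul_lie, lie_zsmul, hd,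
        ← sum_coeff_smul s]
      simp only [map_zsmul, LinearMap.smul_apply, hpair, Finset.smul_sum, smul_smul, ← mul_assoc,
        hlie]
      simp only [mul_comm]
    all_goals simp +contextual [-lie_skew]
  · intro k
    rw [pairing_basis, hp, one_smul]
  · intro i j
    rw [pairing_basis, map_zsmul, Module.Basis.constr_basis, ← hgen]

end Monomial

/-! ### Relations between symbols of basis vectors -/

section Symbols

variable {F L ι : Type*} [Field F] [LieRing L] [LieAlgebra F L] {b : Module.Basis ι F L}
  {c : ι → ι → ℤ × ι}

theorem IsLieTable.tmul_comm (hc : IsLieTable b c) (i j : ι) {k : ι} (h : c i j = (1, k)) (x : L) :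
    tmul F (b k) x = -tmul F x (b k) := by
  have hk : ⁅b i, b j⁆ = b k := by rw [hc, h, one_smul]
  rw [← hk, lie_tmul_comm]

theorem IsLieTable.tmul_self (hc : IsLieTable b c) (i j : ι) {k : ι} (h : c i j = (1, k)) :
    tmul F (b k) (b k) = 0 := by
  have hk : ⁅b i, b j⁆ = b k := by rw [hc, h, one_smul]
  rw [← hk, lie_tmul_lie_self]

theorem IsLieTable.tmul_cyclic (hc : IsLieTable b c) (i j k : ι) :
    (c i j).1 • tmul F (b (c i j).2) (b k) + (c j k).1 • tmul F (b (c j k).2) (b i) +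
      (c k i).1 • tmul F (b (c k i).2) (b j) = 0 := by
  have h (x y : L) (r : ℤ) : tmul F (r • x) y = r • tmul F x y :=
    LinearMap.map_smul_of_tower ((tmulₗ F L).flip y) r x
  rw [← h, ← h, ← h, ← hc, ← hc, ← hc, lie_tmul_cyclic]

theorem isLieTable_ofEquivFun {n : ℕ} {e : L ≃ₗ[F] (Fin n → F)}
    {β : (Fin n → F) → (Fin n → F) → Fin n → F} (hβ : ∀ u v, e ⁅u, v⁆ = β (e u) (e v))
    {c : Fin n → Fin n → ℤ × Fin n}
    (hc : ∀ i j k, β (Pi.single i 1) (Pi.single j 1) k = (coeff (c i j) k : F)) :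
    IsLieTable (Module.Basis.ofEquivFun e) c := by
  intro i j
  refine e.injective ?_
  rw [hβ, map_zsmul]
  ext k
  simp [hc, coeff, Pi.single_apply, eq_comm]

end Symbols

/-! ### Abelian, coordinate and Heisenberg Lie algebras -/

section Examples

variable (F : Type*) [Field F]

/-- The standard basis of `A(n)`. -/
noncomputable def abelianBasis (n : ℕ) : Module.Basis (Fin n) F (AbelianLie F n) :=
  .ofEquivFun (LinearEquiv.refl F (Fin n → F))

theorem isLieTable_abelianBasis (n : ℕ) : IsLieTable (abelianBasis F n) fun i _ => (0, i) :=
  fun i _ => (zero_smul ℤ (abelianBasis F n i)).symm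

theorem nonempty_lieEquiv_abelianLie (n : ℕ) :
    Nonempty (NonabelianTensorSquare F (AbelianLie F n) ≃ₗ⁅F⁆ AbelianLie F (n * n)) := by
  refine nonempty_lieEquiv_of_table (isLieTable_abelianBasis F n) (isLieTable_abelianBasis F _)
    (fun i j => (1, finProdFinEquiv (i, j))) finProdFinEquiv.symm (fun k => ?_) ?_ ?_ ?_ ?_
  · exact congrArg (Prod.mk 1) (finProdFinEquiv.apply_symm_apply k)
  all_goals simp [coeff]

/-- The standard basis of `CoordLie B`. -/
noncomputable def coordBasis {F : Type*} [Field F] {n : ℕ} (B : CoordBracket F n) :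
    Module.Basis (Fin n) F (CoordLie B) :=
  .ofEquivFun (LinearEquiv.refl F (Fin n → F) : CoordLie B ≃ₗ[F] (Fin n → F))

/-- Coordinates on `H(1) ⊕ A(6)` with respect to the basis `a, -a + y₀, b, z, y₁, …, y₅`, where
`a, b, z` with `[a, b] = z` is the standard basis of `H(1)` and `y₀, …, y₅` that of `A(6)`. The
vectors `a` and `-a + y₀` correspond to symbols `x₁ ⊗ x₂` and `x₂ ⊗ x₁`, whose sum is central; with
this choice every symbol of basis vectors is a multiple of a single basis vector. -/
def heisenbergProdCoords : (HeisenbergLie F 1 × AbelianLie F 6) ≃ₗ[F] (Fin 9 → F) where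
  toFun m := ![m.1.1 0 + m.2 0, m.2 0, m.1.2.1 0, m.1.2.2, m.2 1, m.2 2, m.2 3, m.2 4, m.2 5]
  invFun v := ((![v 0 - v 1], ![v 2], v 3), ![v 1, v 4, v 5, v 6, v 7, v 8])
  map_add' u v := by
    ext i
    fin_cases i
    · exact add_add_add_comm _ _ _ _
    all_goals rfl
  map_smul' r u := by
    ext i
    fin_cases i
    · exact (mul_add r _ _).symm
    all_goals rfl
  left_inv m := Prod.ext
    (Prod.ext (funext fun i => by fin_cases i; exact add_sub_cancel_right _ _)
      (Prod.ext (funext fun i => by fin_cases i; rfl) rfl))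
    (funext fun i => by fin_cases i <;> rfl)
  right_inv v := by
    ext i
    fin_cases i
    · exact sub_add_cancel _ _
    all_goals rfl

/-- The basis `a, -a + y₀, b, z, y₁, …, y₅` of `H(1) ⊕ A(6)` described at
`heisenbergProdCoords`. -/
noncomputable def heisenbergProdBasis :
    Module.Basis (Fin 9) F (HeisenbergLie F 1 × AbelianLie F 6) :=
  .ofEquivFun (heisenbergProdCoords F)

/-- The brackets of the vectors of `heisenbergProdBasis`: for `a, -a + y₀, b` in the positions
`0, 1, 2` and `z` in the position `3`, they are `[a, b] = z` and `[-a + y₀, b] = -z`, together with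
those that follow by antisymmetry. -/
def heisenbergProdTable (i j : Fin 9) : ℤ × Fin 9 :=
  (((if i = 0 then 1 else 0) - (if i = 1 then 1 else 0)) * (if j = 2 then 1 else 0) -
    (if i = 2 then 1 else 0) * ((if j = 0 then 1 else 0) - (if j = 1 then 1 else 0)), 3)

theorem isLieTable_heisenbergProdBasis :
    IsLieTable (heisenbergProdBasis F) heisenbergProdTable := by
  refine isLieTable_ofEquivFun
    (β := fun u v => Pi.single 3 ((u 0 - u 1) * v 2 - u 2 * (v 0 - v 1))) (fun u v => ?_)
    fun i j k => ?_
  · ext i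
    rcases eq_or_ne i 3 with rfl | hi
    · rw [Pi.single_eq_same]
      refine (Fin.sum_univ_one fun i => u.1.1 i * v.1.2.1 i - u.1.2.1 i * v.1.1 i).trans ?_
      simp [heisenbergProdCoords]
    · rw [Pi.single_eq_of_ne hi]
      fin_cases i
      · exact add_zero (0 : F)
      · rfl
      · rfl
      · exact absurd rfl hi
      all_goals rfl
  · simp [heisenbergProdTable, coeff, Pi.single_apply, eq_comm]

/-! ### The Lie algebras `L_{5,2}, …, L_{5,9}`

Indices start at zero: the index `i` stands for the basis vector `x_{i+1}`. -/

/-- The brackets of basis vectors of `L5_2`. -/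
def lieTable5_2 : Fin 5 → Fin 5 → ℤ × Fin 5
  | 0, 1 => (1, 2)
  | 1, 0 => (-1, 2)
  | _, _ => (0, 0)

/-- The symbols of basis vectors of `L5_2` as multiples of those listed by `tensorGens5_2`. -/
def tensorTable5_2 : Fin 5 → Fin 5 → ℤ × Fin 18
  | 0, 0 => (1, 0)
  | 0, 1 => (1, 1)
  | 0, 3 => (1, 2)
  | 0, 4 => (1, 3)
  | 1, 0 => (1, 4)
  | 1, 1 => (1, 5)
  | 1, 3 => (1, 6)
  | 1, 4 => (1, 7)
  | 3, 0 => (1, 8)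
  | 3, 1 => (1, 9)
  | 3, 3 => (1, 10)
  | 3, 4 => (1, 11)
  | 4, 0 => (1, 12)
  | 4, 1 => (1, 13)
  | 4, 3 => (1, 14)
  | 4, 4 => (1, 15)
  | 0, 2 => (1, 16)
  | 2, 0 => (-1, 16)
  | 1, 2 => (1, 17)
  | 2, 1 => (-1, 17)
  | _, _ => (0, 0)

/-- The pairs of basis vectors of `L5_2` whose symbols form a basis of the tensor square. -/
def tensorGens5_2 : Fin 18 → Fin 5 × Fin 5 :=
  ![(0, 0), (0, 1), (0, 3), (0, 4), (1, 0), (1, 1), (1, 3), (1, 4), (3, 0), (3, 1), (3, 3),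
  (3, 4), (4, 0), (4, 1), (4, 3), (4, 4), (0, 2), (1, 2)]

/-- Coordinates on `L5_2` with respect to its standard basis. -/
def coords5_2 : L5_2 F ≃ₗ[F] (Fin 5 → F) where
  toFun u := ![u.1.1 0, u.1.2.1 0, u.1.2.2, u.2 0, u.2 1]
  invFun v := ((![v 0], ![v 1], v 2), ![v 3, v 4])
  map_add' u v := by ext i; fin_cases i <;> rfl
  map_smul' r u := by ext i; fin_cases i <;> rfl
  left_inv u := Prod.ext (Prod.ext (funext fun i => by fin_cases i; rfl)
    (Prod.ext (funext fun i => by fin_cases i; rfl) rfl)) (funext fun i => by fin_cases i <;> rfl)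
  right_inv v := by ext i; fin_cases i <;> rfl

/-- The standard basis of `L5_2`. -/
noncomputable def basis5_2 : Module.Basis (Fin 5) F (L5_2 F) := .ofEquivFun (coords5_2 F)

theorem isLieTable5_2 : IsLieTable (basis5_2 F) lieTable5_2 := by
  refine isLieTable_ofEquivFun (β := fun u v => ![0, 0, u 0 * v 1 - u 1 * v 0, 0, 0])
    (fun u v => ?_) fun i j k => ?_
  · ext i
    fin_cases i
    · rfl
    · rfl
    · exact Fin.sum_univ_one fun i => u.1.1 i * v.1.2.1 i - u.1.2.1 i * v.1.1 i
    · rfl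
    · rfl
  · fin_cases i <;> fin_cases j <;> fin_cases k <;> simp [lieTable5_2, coeff]

theorem nonempty_lieEquiv5_2 :
    Nonempty (NonabelianTensorSquare F (L5_2 F) ≃ₗ⁅F⁆ AbelianLie F 18) := by
  have hc := isLieTable5_2 F
  refine nonempty_lieEquiv_of_table hc (isLieTable_abelianBasis F 18) tensorTable5_2 tensorGens5_2
    (by decide) (by decide +kernel) (by decide +kernel) (by decide +kernel)
    fun i j => ?_
  set b := basis5_2 F
  have c2 := hc.tmul_comm 0 1 (k := 2) rfl
  have t22 := hc.tmul_self 0 1 (k := 2) rfl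
  have t32 : tmul F (b 3) (b 2) = 0 := by
    simpa [lieTable5_2, c2 (b 3), t22] using hc.tmul_cyclic 0 1 3
  have t42 : tmul F (b 4) (b 2) = 0 := by
    simpa [lieTable5_2, c2 (b 4), t22, t32] using hc.tmul_cyclic 0 1 4
  fin_cases i <;> fin_cases j <;>
    simp [tensorTable5_2, tensorGens5_2, c2 (b 0), c2 (b 1), c2 (b 3), c2 (b 4), t22, t32, t42]

/-- The brackets of basis vectors of `L5_3`. -/
def lieTable5_3 : Fin 5 → Fin 5 → ℤ × Fin 5
  | 0, 1 => (1, 2)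
  | 1, 0 => (-1, 2)
  | 0, 2 => (1, 3)
  | 2, 0 => (-1, 3)
  | _, _ => (0, 0)

/-- The symbols of basis vectors of `L5_3` as multiples of those listed by `tensorGens5_3`. -/
def tensorTable5_3 : Fin 5 → Fin 5 → ℤ × Fin 12
  | 0, 0 => (1, 0)
  | 0, 1 => (1, 1)
  | 0, 4 => (1, 2)
  | 1, 0 => (1, 3)
  | 1, 1 => (1, 4)
  | 1, 4 => (1, 5)
  | 4, 0 => (1, 6)
  | 4, 1 => (1, 7)
  | 4, 4 => (1, 8)
  | 0, 2 => (1, 9)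
  | 2, 0 => (-1, 9)
  | 0, 3 => (1, 10)
  | 3, 0 => (-1, 10)
  | 1, 2 => (1, 11)
  | 2, 1 => (-1, 11)
  | _, _ => (0, 0)

/-- The pairs of basis vectors of `L5_3` whose symbols form a basis of the tensor square. -/
def tensorGens5_3 : Fin 12 → Fin 5 × Fin 5 :=
  ![(0, 0), (0, 1), (0, 4), (1, 0), (1, 1), (1, 4), (4, 0), (4, 1), (4, 4), (0, 2), (0, 3), (1, 2)]

/-- Coordinates on `L5_3` with respect to its standard basis. -/
def coords5_3 : L5_3 F ≃ₗ[F] (Fin 5 → F) where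
  toFun u := ![u.1 0, u.1 1, u.1 2, u.1 3, u.2 0]
  invFun v := (![v 0, v 1, v 2, v 3], ![v 4])
  map_add' u v := by ext i; fin_cases i <;> rfl
  map_smul' r u := by ext i; fin_cases i <;> rfl
  left_inv u := Prod.ext (funext fun i => by fin_cases i <;> rfl)
    (funext fun i => by fin_cases i; rfl)
  right_inv v := by ext i; fin_cases i <;> rfl

/-- The standard basis of `L5_3`. -/
noncomputable def basis5_3 : Module.Basis (Fin 5) F (L5_3 F) := .ofEquivFun (coords5_3 F)

theorem isLieTable5_3 : IsLieTable (basis5_3 F) lieTable5_3 := by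
  refine isLieTable_ofEquivFun
    (β := fun u v => ![0, 0, u 0 * v 1 - u 1 * v 0, u 0 * v 2 - u 2 * v 0, 0])
    (fun u v => ?_) fun i j k => ?_
  · ext i
    fin_cases i
    all_goals rfl
  · fin_cases i <;> fin_cases j <;> fin_cases k <;> simp [lieTable5_3, coeff]

theorem nonempty_lieEquiv5_3 :
    Nonempty (NonabelianTensorSquare F (L5_3 F) ≃ₗ⁅F⁆ AbelianLie F 12) := by
  have hc := isLieTable5_3 F
  refine nonempty_lieEquiv_of_table hc (isLieTable_abelianBasis F 12) tensorTable5_3 tensorGens5_3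
    (by decide) (by decide +kernel) (by decide +kernel) (by decide +kernel)
    fun i j => ?_
  set b := basis5_3 F
  have c2 := hc.tmul_comm 0 1 (k := 2) rfl
  have c3 := hc.tmul_comm 0 2 (k := 3) rfl
  have t22 := hc.tmul_self 0 1 (k := 2) rfl
  have t33 := hc.tmul_self 0 2 (k := 3) rfl
  have t13 : tmul F (b 1) (b 3) = 0 := by
    simpa [lieTable5_3, c3 (b 1), t22, t33] using hc.tmul_cyclic 0 1 2
  have t23 : tmul F (b 2) (b 3) = 0 := by
    simpa [lieTable5_3, t22, t33, t13] using hc.tmul_cyclic 0 1 3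
  have t42 : tmul F (b 4) (b 2) = 0 := by
    simpa [lieTable5_3, c2 (b 4), t22, t33, t13, t23] using hc.tmul_cyclic 0 1 4
  have t43 : tmul F (b 4) (b 3) = 0 := by
    simpa [lieTable5_3, c3 (b 4), t22, t33, t13, t23, t42] using hc.tmul_cyclic 0 2 4
  fin_cases i <;> fin_cases j <;>
    simp [tensorTable5_3, tensorGens5_3, c2 (b 0), c2 (b 1), c2 (b 4), c3 (b 0), c3 (b 1),
    c3 (b 2), c3 (b 4), t22, t33, t13, t23, t42, t43]

/-- The brackets of basis vectors of `L5_4`. -/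
def lieTable5_4 : Fin 5 → Fin 5 → ℤ × Fin 5
  | 0, 1 => (1, 4)
  | 1, 0 => (-1, 4)
  | 2, 3 => (1, 4)
  | 3, 2 => (-1, 4)
  | _, _ => (0, 0)

/-- The symbols of basis vectors of `L5_4` as multiples of those listed by `tensorGens5_4`. -/
def tensorTable5_4 : Fin 5 → Fin 5 → ℤ × Fin 16
  | 0, 0 => (1, 0)
  | 0, 1 => (1, 1)
  | 0, 2 => (1, 2)
  | 0, 3 => (1, 3)
  | 1, 0 => (1, 4)
  | 1, 1 => (1, 5)
  | 1, 2 => (1, 6)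
  | 1, 3 => (1, 7)
  | 2, 0 => (1, 8)
  | 2, 1 => (1, 9)
  | 2, 2 => (1, 10)
  | 2, 3 => (1, 11)
  | 3, 0 => (1, 12)
  | 3, 1 => (1, 13)
  | 3, 2 => (1, 14)
  | 3, 3 => (1, 15)
  | _, _ => (0, 0)

/-- The pairs of basis vectors of `L5_4` whose symbols form a basis of the tensor square. -/
def tensorGens5_4 : Fin 16 → Fin 5 × Fin 5 :=
  ![(0, 0), (0, 1), (0, 2), (0, 3), (1, 0), (1, 1), (1, 2), (1, 3), (2, 0), (2, 1), (2, 2),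
  (2, 3), (3, 0), (3, 1), (3, 2), (3, 3)]

/-- Coordinates on `L5_4` with respect to its standard basis. -/
def coords5_4 : L5_4 F ≃ₗ[F] (Fin 5 → F) where
  toFun u := ![u.1 0, u.2.1 0, u.1 1, u.2.1 1, u.2.2]
  invFun v := (![v 0, v 2], ![v 1, v 3], v 4)
  map_add' u v := by ext i; fin_cases i <;> rfl
  map_smul' r u := by ext i; fin_cases i <;> rfl
  left_inv u := Prod.ext (funext fun i => by fin_cases i <;> rfl)
    (Prod.ext (funext fun i => by fin_cases i <;> rfl) rfl)
  right_inv v := by ext i; fin_cases i <;> rfl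

/-- The standard basis of `L5_4`. -/
noncomputable def basis5_4 : Module.Basis (Fin 5) F (L5_4 F) := .ofEquivFun (coords5_4 F)

theorem isLieTable5_4 : IsLieTable (basis5_4 F) lieTable5_4 := by
  refine isLieTable_ofEquivFun
    (β := fun u v => ![0, 0, 0, 0, (u 0 * v 1 - u 1 * v 0) + (u 2 * v 3 - u 3 * v 2)])
    (fun u v => ?_) fun i j k => ?_
  · ext i
    fin_cases i
    · rfl
    · rfl
    · rfl
    · rfl
    · exact Fin.sum_univ_two fun i => u.1 i * v.2.1 i - u.2.1 i * v.1 i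
  · fin_cases i <;> fin_cases j <;> fin_cases k <;> simp [lieTable5_4, coeff]

theorem nonempty_lieEquiv5_4 :
    Nonempty (NonabelianTensorSquare F (L5_4 F) ≃ₗ⁅F⁆ AbelianLie F 16) := by
  have hc := isLieTable5_4 F
  refine nonempty_lieEquiv_of_table hc (isLieTable_abelianBasis F 16) tensorTable5_4 tensorGens5_4
    (by decide) (by decide +kernel) (by decide +kernel) (by decide +kernel)
    fun i j => ?_
  set b := basis5_4 F
  have c4 := hc.tmul_comm 0 1 (k := 4) rfl
  have t44 := hc.tmul_self 0 1 (k := 4) rfl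
  have t04 : tmul F (b 0) (b 4) = 0 := by
    simpa [lieTable5_4, c4 (b 0), t44] using hc.tmul_cyclic 2 3 0
  have t14 : tmul F (b 1) (b 4) = 0 := by
    simpa [lieTable5_4, c4 (b 1), t44, t04] using hc.tmul_cyclic 2 3 1
  have t24 : tmul F (b 2) (b 4) = 0 := by
    simpa [lieTable5_4, c4 (b 2), t44, t04, t14] using hc.tmul_cyclic 0 1 2
  have t34 : tmul F (b 3) (b 4) = 0 := by
    simpa [lieTable5_4, c4 (b 3), t44, t04, t14, t24] using hc.tmul_cyclic 0 1 3
  fin_cases i <;> fin_cases j <;>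
    simp [tensorTable5_4, tensorGens5_4, c4 (b 0), c4 (b 1), c4 (b 2), c4 (b 3), t44, t04, t14,
    t24, t34]

/-- The brackets of basis vectors of `L5_5`. -/
def lieTable5_5 : Fin 5 → Fin 5 → ℤ × Fin 5
  | 0, 1 => (1, 2)
  | 1, 0 => (-1, 2)
  | 0, 2 => (1, 4)
  | 2, 0 => (-1, 4)
  | 1, 3 => (1, 4)
  | 3, 1 => (-1, 4)
  | _, _ => (0, 0)

/-- The symbols of basis vectors of `L5_5` as multiples of those listed by `tensorGens5_5`. -/
def tensorTable5_5 : Fin 5 → Fin 5 → ℤ × Fin 12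
  | 0, 0 => (1, 0)
  | 0, 1 => (1, 1)
  | 0, 3 => (1, 2)
  | 1, 0 => (1, 3)
  | 1, 1 => (1, 4)
  | 1, 3 => (1, 5)
  | 3, 0 => (1, 6)
  | 3, 1 => (1, 7)
  | 3, 3 => (1, 8)
  | 0, 2 => (1, 9)
  | 2, 0 => (-1, 9)
  | 1, 2 => (1, 10)
  | 2, 1 => (-1, 10)
  | 0, 4 => (1, 11)
  | 4, 0 => (-1, 11)
  | 2, 3 => (1, 11)
  | 3, 2 => (-1, 11)
  | _, _ => (0, 0)

/-- The pairs of basis vectors of `L5_5` whose symbols form a basis of the tensor square. -/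
def tensorGens5_5 : Fin 12 → Fin 5 × Fin 5 :=
  ![(0, 0), (0, 1), (0, 3), (1, 0), (1, 1), (1, 3), (3, 0), (3, 1), (3, 3), (0, 2), (1, 2), (0, 4)]

theorem isLieTable5_5 : IsLieTable (coordBasis (L5_5.bracket F)) lieTable5_5 := by
  refine isLieTable_ofEquivFun (β := (L5_5.bracket F).br) (fun _ _ => rfl) fun i j k => ?_
  fin_cases i <;> fin_cases j <;> fin_cases k <;> simp [L5_5.bracket, lieTable5_5, coeff]

theorem nonempty_lieEquiv5_5 :
    Nonempty (NonabelianTensorSquare F (L5_5 F) ≃ₗ⁅F⁆ AbelianLie F 12) := by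
  have hc := isLieTable5_5 F
  refine nonempty_lieEquiv_of_table hc (isLieTable_abelianBasis F 12) tensorTable5_5 tensorGens5_5
    (by decide) (by decide +kernel) (by decide +kernel) (by decide +kernel)
    fun i j => ?_
  set b := coordBasis (L5_5.bracket F)
  have c2 := hc.tmul_comm 0 1 (k := 2) rfl
  have c4 := hc.tmul_comm 0 2 (k := 4) rfl
  have t22 := hc.tmul_self 0 1 (k := 2) rfl
  have t44 := hc.tmul_self 0 2 (k := 4) rfl
  have t32 : tmul F (b 3) (b 2) = -tmul F (b 0) (b 4) := by
    simpa [lieTable5_5, c2 (b 3), c4 (b 0), t22, t44, neg_add_eq_zero] using hc.tmul_cyclic 0 1 3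
  have t14 : tmul F (b 1) (b 4) = 0 := by
    simpa [lieTable5_5, c4 (b 1), t22, t44, t32] using hc.tmul_cyclic 0 1 2
  have t24 : tmul F (b 2) (b 4) = 0 := by
    simpa [lieTable5_5, t22, t44, t32, t14] using hc.tmul_cyclic 0 1 4
  have t34 : tmul F (b 3) (b 4) = 0 := by
    simpa [lieTable5_5, c4 (b 3), t22, t44, t32, t14, t24] using hc.tmul_cyclic 0 2 3
  fin_cases i <;> fin_cases j <;>
    simp [tensorTable5_5, tensorGens5_5, c2 (b 0), c2 (b 1), c2 (b 3), c4 (b 0), c4 (b 1),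
    c4 (b 2), c4 (b 3), t22, t44, t32, t14, t24, t34]

/-- The brackets of basis vectors of `L5_6`. -/
def lieTable5_6 : Fin 5 → Fin 5 → ℤ × Fin 5
  | 0, 1 => (1, 2)
  | 1, 0 => (-1, 2)
  | 0, 2 => (1, 3)
  | 2, 0 => (-1, 3)
  | 0, 3 => (1, 4)
  | 3, 0 => (-1, 4)
  | 1, 2 => (1, 4)
  | 2, 1 => (-1, 4)
  | _, _ => (0, 0)

/-- The symbols of basis vectors of `L5_6` as multiples of those listed by `tensorGens5_6`. -/
def tensorTable5_6 : Fin 5 → Fin 5 → ℤ × Fin 9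
  | 0, 1 => (1, 0)
  | 1, 0 => (1, 1)
  | 0, 2 => (1, 2)
  | 2, 0 => (-1, 2)
  | 2, 3 => (1, 3)
  | 3, 2 => (-1, 3)
  | 0, 0 => (1, 4)
  | 1, 1 => (1, 5)
  | 0, 3 => (1, 6)
  | 3, 0 => (-1, 6)
  | 0, 4 => (1, 7)
  | 4, 0 => (-1, 7)
  | 1, 2 => (1, 8)
  | 2, 1 => (-1, 8)
  | 1, 3 => (1, 7)
  | 3, 1 => (-1, 7)
  | 1, 4 => (-1, 3)
  | 4, 1 => (1, 3)
  | _, _ => (0, 0)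

/-- The pairs of basis vectors of `L5_6` whose symbols form a basis of the tensor square. -/
def tensorGens5_6 : Fin 9 → Fin 5 × Fin 5 :=
  ![(0, 1), (1, 0), (0, 2), (2, 3), (0, 0), (1, 1), (0, 3), (0, 4), (1, 2)]

theorem isLieTable5_6 : IsLieTable (coordBasis (L5_6.bracket F)) lieTable5_6 := by
  refine isLieTable_ofEquivFun (β := (L5_6.bracket F).br) (fun _ _ => rfl) fun i j k => ?_
  fin_cases i <;> fin_cases j <;> fin_cases k <;> simp [L5_6.bracket, lieTable5_6, coeff]

theorem nonempty_lieEquiv5_6 :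
    Nonempty (NonabelianTensorSquare F (L5_6 F) ≃ₗ⁅F⁆ (HeisenbergLie F 1 × AbelianLie F 6)) := by
  have hc := isLieTable5_6 F
  refine nonempty_lieEquiv_of_table hc (isLieTable_heisenbergProdBasis F) tensorTable5_6
    tensorGens5_6 (by decide) (by decide +kernel) (by decide +kernel) (by decide +kernel)
    fun i j => ?_
  set b := coordBasis (L5_6.bracket F)
  have c2 := hc.tmul_comm 0 1 (k := 2) rfl
  have c3 := hc.tmul_comm 0 2 (k := 3) rfl
  have c4 := hc.tmul_comm 0 3 (k := 4) rfl
  have t22 := hc.tmul_self 0 1 (k := 2) rfl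
  have t33 := hc.tmul_self 0 2 (k := 3) rfl
  have t44 := hc.tmul_self 0 3 (k := 4) rfl
  have t13 : tmul F (b 1) (b 3) = tmul F (b 0) (b 4) := by
    simpa [lieTable5_6, c3 (b 1), c4 (b 0), t22, t33, t44, neg_add_eq_zero, add_neg_eq_zero]
      using hc.tmul_cyclic 1 0 2
  have t14 : tmul F (b 1) (b 4) = -tmul F (b 2) (b 3) := by
    simpa [lieTable5_6, c2 (b 3), c4 (b 1), t22, t33, t44, t13, add_eq_zero_iff_eq_neg']
      using hc.tmul_cyclic 0 1 3
  have t24 : tmul F (b 2) (b 4) = 0 := by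
    simpa [lieTable5_6, t22, t33, t44, t13, t14] using hc.tmul_cyclic 0 1 4
  have t34 : tmul F (b 3) (b 4) = 0 := by
    simpa [lieTable5_6, t22, t33, t44, t13, t14, t24] using hc.tmul_cyclic 0 2 4
  fin_cases i <;> fin_cases j <;>
    simp [tensorTable5_6, tensorGens5_6, c2 (b 0), c2 (b 1), c3 (b 0), c3 (b 1), c3 (b 2),
    c4 (b 0), c4 (b 1), c4 (b 2), c4 (b 3), t22, t33, t44, t13, t14, t24, t34]

/-- The brackets of basis vectors of `L5_7`. -/
def lieTable5_7 : Fin 5 → Fin 5 → ℤ × Fin 5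
  | 0, 1 => (1, 2)
  | 1, 0 => (-1, 2)
  | 0, 2 => (1, 3)
  | 2, 0 => (-1, 3)
  | 0, 3 => (1, 4)
  | 3, 0 => (-1, 4)
  | _, _ => (0, 0)

/-- The symbols of basis vectors of `L5_7` as multiples of those listed by `tensorGens5_7`. -/
def tensorTable5_7 : Fin 5 → Fin 5 → ℤ × Fin 9
  | 0, 1 => (1, 0)
  | 1, 0 => (1, 1)
  | 0, 2 => (1, 2)
  | 2, 0 => (-1, 2)
  | 2, 3 => (1, 3)
  | 3, 2 => (-1, 3)
  | 0, 0 => (1, 4)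
  | 1, 1 => (1, 5)
  | 0, 3 => (1, 6)
  | 3, 0 => (-1, 6)
  | 0, 4 => (1, 7)
  | 4, 0 => (-1, 7)
  | 1, 2 => (1, 8)
  | 2, 1 => (-1, 8)
  | 1, 4 => (-1, 3)
  | 4, 1 => (1, 3)
  | _, _ => (0, 0)

/-- The pairs of basis vectors of `L5_7` whose symbols form a basis of the tensor square. -/
def tensorGens5_7 : Fin 9 → Fin 5 × Fin 5 :=
  ![(0, 1), (1, 0), (0, 2), (2, 3), (0, 0), (1, 1), (0, 3), (0, 4), (1, 2)]

theorem isLieTable5_7 : IsLieTable (coordBasis (L5_7.bracket F)) lieTable5_7 := by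
  refine isLieTable_ofEquivFun (β := (L5_7.bracket F).br) (fun _ _ => rfl) fun i j k => ?_
  fin_cases i <;> fin_cases j <;> fin_cases k <;> simp [L5_7.bracket, lieTable5_7, coeff]

theorem nonempty_lieEquiv5_7 :
    Nonempty (NonabelianTensorSquare F (L5_7 F) ≃ₗ⁅F⁆ (HeisenbergLie F 1 × AbelianLie F 6)) := by
  have hc := isLieTable5_7 F
  refine nonempty_lieEquiv_of_table hc (isLieTable_heisenbergProdBasis F) tensorTable5_7
    tensorGens5_7 (by decide) (by decide +kernel) (by decide +kernel) (by decide +kernel)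
    fun i j => ?_
  set b := coordBasis (L5_7.bracket F)
  have c2 := hc.tmul_comm 0 1 (k := 2) rfl
  have c3 := hc.tmul_comm 0 2 (k := 3) rfl
  have c4 := hc.tmul_comm 0 3 (k := 4) rfl
  have t22 := hc.tmul_self 0 1 (k := 2) rfl
  have t33 := hc.tmul_self 0 2 (k := 3) rfl
  have t44 := hc.tmul_self 0 3 (k := 4) rfl
  have t13 : tmul F (b 1) (b 3) = 0 := by
    simpa [lieTable5_7, c3 (b 1), t22, t33, t44] using hc.tmul_cyclic 0 1 2
  have t14 : tmul F (b 1) (b 4) = -tmul F (b 2) (b 3) := by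
    simpa [lieTable5_7, c2 (b 3), c4 (b 1), t22, t33, t44, t13, add_eq_zero_iff_eq_neg']
      using hc.tmul_cyclic 0 1 3
  have t24 : tmul F (b 2) (b 4) = 0 := by
    simpa [lieTable5_7, t22, t33, t44, t13, t14] using hc.tmul_cyclic 0 1 4
  have t34 : tmul F (b 3) (b 4) = 0 := by
    simpa [lieTable5_7, t22, t33, t44, t13, t14, t24] using hc.tmul_cyclic 0 2 4
  fin_cases i <;> fin_cases j <;>
    simp [tensorTable5_7, tensorGens5_7, c2 (b 0), c2 (b 1), c3 (b 0), c3 (b 1), c3 (b 2),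
    c4 (b 0), c4 (b 1), c4 (b 2), c4 (b 3), t22, t33, t44, t13, t14, t24, t34]

/-- The brackets of basis vectors of `L5_8`. -/
def lieTable5_8 : Fin 5 → Fin 5 → ℤ × Fin 5
  | 0, 1 => (1, 3)
  | 1, 0 => (-1, 3)
  | 0, 2 => (1, 4)
  | 2, 0 => (-1, 4)
  | _, _ => (0, 0)

/-- The symbols of basis vectors of `L5_8` as multiples of those listed by `tensorGens5_8`. -/
def tensorTable5_8 : Fin 5 → Fin 5 → ℤ × Fin 14
  | 0, 0 => (1, 0)
  | 0, 1 => (1, 1)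
  | 0, 2 => (1, 2)
  | 1, 0 => (1, 3)
  | 1, 1 => (1, 4)
  | 1, 2 => (1, 5)
  | 2, 0 => (1, 6)
  | 2, 1 => (1, 7)
  | 2, 2 => (1, 8)
  | 0, 3 => (1, 9)
  | 3, 0 => (-1, 9)
  | 0, 4 => (1, 10)
  | 4, 0 => (-1, 10)
  | 1, 3 => (1, 11)
  | 3, 1 => (-1, 11)
  | 2, 4 => (1, 12)
  | 4, 2 => (-1, 12)
  | 1, 4 => (1, 13)
  | 4, 1 => (-1, 13)
  | 2, 3 => (1, 13)
  | 3, 2 => (-1, 13)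
  | _, _ => (0, 0)

/-- The pairs of basis vectors of `L5_8` whose symbols form a basis of the tensor square. -/
def tensorGens5_8 : Fin 14 → Fin 5 × Fin 5 :=
  ![(0, 0), (0, 1), (0, 2), (1, 0), (1, 1), (1, 2), (2, 0), (2, 1), (2, 2), (0, 3), (0, 4),
  (1, 3), (2, 4), (1, 4)]

theorem isLieTable5_8 : IsLieTable (coordBasis (L5_8.bracket F)) lieTable5_8 := by
  refine isLieTable_ofEquivFun (β := (L5_8.bracket F).br) (fun _ _ => rfl) fun i j k => ?_
  fin_cases i <;> fin_cases j <;> fin_cases k <;> simp [L5_8.bracket, lieTable5_8, coeff]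

theorem nonempty_lieEquiv5_8 :
    Nonempty (NonabelianTensorSquare F (L5_8 F) ≃ₗ⁅F⁆ AbelianLie F 14) := by
  have hc := isLieTable5_8 F
  refine nonempty_lieEquiv_of_table hc (isLieTable_abelianBasis F 14) tensorTable5_8 tensorGens5_8
    (by decide) (by decide +kernel) (by decide +kernel) (by decide +kernel)
    fun i j => ?_
  set b := coordBasis (L5_8.bracket F)
  have c3 := hc.tmul_comm 0 1 (k := 3) rfl
  have c4 := hc.tmul_comm 0 2 (k := 4) rfl
  have t33 := hc.tmul_self 0 1 (k := 3) rfl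
  have t44 := hc.tmul_self 0 2 (k := 4) rfl
  have t23 : tmul F (b 2) (b 3) = tmul F (b 1) (b 4) := by
    simpa [lieTable5_8, c3 (b 2), c4 (b 1), t33, t44, neg_add_eq_zero, add_neg_eq_zero]
      using hc.tmul_cyclic 0 1 2
  have t34 : tmul F (b 3) (b 4) = 0 := by
    simpa [lieTable5_8, t33, t44, t23] using hc.tmul_cyclic 0 1 4
  fin_cases i <;> fin_cases j <;>
    simp [tensorTable5_8, tensorGens5_8, c3 (b 0), c3 (b 1), c3 (b 2), c4 (b 0), c4 (b 1),
    c4 (b 2), c4 (b 3), t33, t44, t23, t34]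

/-- The brackets of basis vectors of `L5_9`. -/
def lieTable5_9 : Fin 5 → Fin 5 → ℤ × Fin 5
  | 0, 1 => (1, 2)
  | 1, 0 => (-1, 2)
  | 0, 2 => (1, 3)
  | 2, 0 => (-1, 3)
  | 1, 2 => (1, 4)
  | 2, 1 => (-1, 4)
  | _, _ => (0, 0)

/-- The symbols of basis vectors of `L5_9` as multiples of those listed by `tensorGens5_9`. -/
def tensorTable5_9 : Fin 5 → Fin 5 → ℤ × Fin 9
  | 0, 0 => (1, 0)
  | 0, 1 => (1, 1)
  | 1, 0 => (1, 2)
  | 1, 1 => (1, 3)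
  | 0, 2 => (1, 4)
  | 2, 0 => (-1, 4)
  | 0, 3 => (1, 5)
  | 3, 0 => (-1, 5)
  | 1, 2 => (1, 6)
  | 2, 1 => (-1, 6)
  | 1, 4 => (1, 7)
  | 4, 1 => (-1, 7)
  | 0, 4 => (1, 8)
  | 4, 0 => (-1, 8)
  | 1, 3 => (1, 8)
  | 3, 1 => (-1, 8)
  | _, _ => (0, 0)

/-- The pairs of basis vectors of `L5_9` whose symbols form a basis of the tensor square. -/
def tensorGens5_9 : Fin 9 → Fin 5 × Fin 5 :=
  ![(0, 0), (0, 1), (1, 0), (1, 1), (0, 2), (0, 3), (1, 2), (1, 4), (0, 4)]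

theorem isLieTable5_9 : IsLieTable (coordBasis (L5_9.bracket F)) lieTable5_9 := by
  refine isLieTable_ofEquivFun (β := (L5_9.bracket F).br) (fun _ _ => rfl) fun i j k => ?_
  fin_cases i <;> fin_cases j <;> fin_cases k <;> simp [L5_9.bracket, lieTable5_9, coeff]

theorem nonempty_lieEquiv5_9 :
    Nonempty (NonabelianTensorSquare F (L5_9 F) ≃ₗ⁅F⁆ AbelianLie F 9) := by
  have hc := isLieTable5_9 F
  refine nonempty_lieEquiv_of_table hc (isLieTable_abelianBasis F 9) tensorTable5_9 tensorGens5_9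
    (by decide) (by decide +kernel) (by decide +kernel) (by decide +kernel)
    fun i j => ?_
  set b := coordBasis (L5_9.bracket F)
  have c2 := hc.tmul_comm 0 1 (k := 2) rfl
  have c3 := hc.tmul_comm 0 2 (k := 3) rfl
  have c4 := hc.tmul_comm 1 2 (k := 4) rfl
  have t22 := hc.tmul_self 0 1 (k := 2) rfl
  have t33 := hc.tmul_self 0 2 (k := 3) rfl
  have t44 := hc.tmul_self 1 2 (k := 4) rfl
  have t13 : tmul F (b 1) (b 3) = tmul F (b 0) (b 4) := by
    simpa [lieTable5_9, c3 (b 1), c4 (b 0), t22, t33, t44, neg_add_eq_zero, add_neg_eq_zero]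
      using hc.tmul_cyclic 1 0 2
  have t23 : tmul F (b 2) (b 3) = 0 := by
    simpa [lieTable5_9, t22, t33, t44, t13] using hc.tmul_cyclic 0 1 3
  have t24 : tmul F (b 2) (b 4) = 0 := by
    simpa [lieTable5_9, t22, t33, t44, t13, t23] using hc.tmul_cyclic 0 1 4
  have t34 : tmul F (b 3) (b 4) = 0 := by
    simpa [lieTable5_9, t22, t33, t44, t13, t23, t24] using hc.tmul_cyclic 0 2 4
  fin_cases i <;> fin_cases j <;>
    simp [tensorTable5_9, tensorGens5_9, c2 (b 0), c2 (b 1), c3 (b 0), c3 (b 1), c3 (b 2),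
    c4 (b 0), c4 (b 1), c4 (b 2), c4 (b 3), t22, t33, t44, t13, t23, t24, t34]

end Examples

end NonabelianTensorSquare

theorem corollary2p10 (F : Type*) [Field F] :
    Nonempty (NonabelianTensorSquare F (L5_1 F) ≃ₗ⁅F⁆ AbelianLie F 25) ∧
    Nonempty (NonabelianTensorSquare F (L5_2 F) ≃ₗ⁅F⁆ AbelianLie F 18) ∧
    Nonempty (NonabelianTensorSquare F (L5_3 F) ≃ₗ⁅F⁆ AbelianLie F 12) ∧
    Nonempty (NonabelianTensorSquare F (L5_4 F) ≃ₗ⁅F⁆ AbelianLie F 16) ∧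
    Nonempty (NonabelianTensorSquare F (L5_5 F) ≃ₗ⁅F⁆ AbelianLie F 12) ∧
    Nonempty (NonabelianTensorSquare F (L5_6 F) ≃ₗ⁅F⁆ (HeisenbergLie F 1 × AbelianLie F 6)) ∧
    Nonempty (NonabelianTensorSquare F (L5_7 F) ≃ₗ⁅F⁆ (HeisenbergLie F 1 × AbelianLie F 6)) ∧
    Nonempty (NonabelianTensorSquare F (L5_8 F) ≃ₗ⁅F⁆ AbelianLie F 14) ∧
    Nonempty (NonabelianTensorSquare F (L5_9 F) ≃ₗ⁅F⁆ AbelianLie F 9) :=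
  ⟨NonabelianTensorSquare.nonempty_lieEquiv_abelianLie F 5,
    NonabelianTensorSquare.nonempty_lieEquiv5_2 F,
    NonabelianTensorSquare.nonempty_lieEquiv5_3 F,
    NonabelianTensorSquare.nonempty_lieEquiv5_4 F,
    NonabelianTensorSquare.nonempty_lieEquiv5_5 F,
    NonabelianTensorSquare.nonempty_lieEquiv5_6 F,
    NonabelianTensorSquare.nonempty_lieEquiv5_7 F,
    NonabelianTensorSquare.nonempty_lieEquiv5_8 F,
    NonabelianTensorSquare.nonempty_lieEquiv5_9 F⟩
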